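/- For $k\ge 1$ let $\mathbb N^k$ denote the set of strictly increasing $k$-tuples $\vec n=(n_1<\dots<n_k)$ of natural numbers. Kalton's interlacing graph on $\mathbb N^k$ joins two distinct tuples $\vec n,\vec m$ if they interlace, that is, $n_1\le m_1\le n_2\le m_2\le\dots\le n_k\le m_k$ or $m_1\le n_1\le m_2\le n_2\le\dots\le m_k\le n_k$; $d_{\mathbb K}$ denotes its shortest path metric. The James space $J$, in coordinates with respect to its boundedly complete (summing) basis $(e_i)$, is the space of all real sequences $(a_i)$ with finite norm $$\Big\|\sum_i a_ie_i\Big\|=\sup\Big\{\Big(\sum_{j=1}^{l}\big(\sum_{i\in I_j}a_i\big)^2\Big)^{1/2}: I_1<\dots<I_l \text{ successive finite intervals with no gaps in between}\Big\}.$$ Theorem. The family $(\mathbb N^k,d_{\mathbb K})_{k\ge 1}$ does not equi-coarsely embed into $J$: there do not exist maps $\phi_k:\mathbb N^k\to J$ ($k\ge1$) and nondecreasing functions $\rho,\omega:[0,\infty)\to[0,\infty)$ with $\lim_{t\to\infty}\rho(t)=\infty$ such that $$\rho(d_{\mathbb K}(\vec n,\vec m))\le\|\phi_k(\vec n)-\phi_k(\vec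 m)\|\le\omega(d_{\mathbb K}(\vec n,\vec m))\qquad\text{for all }k\ge1,\ \vec n,\vec m\in\mathbb N^k.$$ The same is true if interlacing is instead defined by $n_1\le m_1<n_2\le m_2<\dots<n_k\le m_k$ or $m_1\le n_1<m_2\le n_2<\dots<m_k\le n_k$. -/

import Mathlib

open Filter
open scoped NNReal

/-! ## Equi-coarse embeddings -/

/-- A family of maps `φ i : X i → Y`, where `d i` is the metric of `X i`, is an equi-coarse
embedding if two nondecreasing functions `ρ, ω : [0,∞) → [0,∞)` with `ρ(t) → ∞` as `t → ∞`
satisfy `ρ (d i x y) ≤ dist (φ i x) (φ i y) ≤ ω (d i x y)` for all `i`, `x`, `y` simultaneously. -/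
def IsEquiCoarseEmbedding {ι : Type*} {X : ι → Type*} {Y : Type*} [MetricSpace Y]
    (d : ∀ i, X i → X i → ℝ≥0) (φ : ∀ i, X i → Y) : Prop :=
  ∃ ρ ω : ℝ≥0 → ℝ≥0, Monotone ρ ∧ Monotone ω ∧ Tendsto ρ atTop atTop ∧
    ∀ i, ∀ x y : X i,
      ρ (d i x y) ≤ nndist (φ i x) (φ i y) ∧ nndist (φ i x) (φ i y) ≤ ω (d i x y)

/-! ## Kalton's interlacing graphs -/

/-- The set of increasing `k`-tuples of natural numbers. -/
def IncTuple (k : ℕ) : Type := {n : Fin k → ℕ // StrictMono n}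

/-- `n₁ ≤ m₁ ≤ n₂ ≤ m₂ ≤ ⋯ ≤ n_k ≤ m_k`. -/
def InterlacesLE {k : ℕ} (n m : IncTuple k) : Prop :=
  (∀ i, n.1 i ≤ m.1 i) ∧ ∀ i j, i < j → m.1 i ≤ n.1 j

/-- `n₁ ≤ m₁ < n₂ ≤ m₂ < ⋯ < n_k ≤ m_k`. -/
def InterlacesLT {k : ℕ} (n m : IncTuple k) : Prop :=
  (∀ i, n.1 i ≤ m.1 i) ∧ ∀ i j, i < j → m.1 i < n.1 j

/-- Kalton's interlacing graph: distinct increasing `k`-tuples `n`, `m` are joined if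
`n₁ ≤ m₁ ≤ n₂ ≤ ⋯ ≤ n_k ≤ m_k` or `m₁ ≤ n₁ ≤ m₂ ≤ ⋯ ≤ m_k ≤ n_k`. -/
def kaltonGraph (k : ℕ) : SimpleGraph (IncTuple k) :=
  SimpleGraph.fromRel InterlacesLE

/-- The variant of the interlacing graph in which distinct tuples `n`, `m` are joined if
`n₁ ≤ m₁ < n₂ ≤ ⋯ < n_k ≤ m_k` or `m₁ ≤ n₁ < m₂ ≤ ⋯ < m_k ≤ n_k`. -/
def strictKaltonGraph (k : ℕ) : SimpleGraph (IncTuple k) :=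
  SimpleGraph.fromRel InterlacesLT

/-- The shortest path metric of `kaltonGraph k` (a connected graph, see below). -/
noncomputable def kaltonDist (k : ℕ) (n m : IncTuple k) : ℝ≥0 :=
  ((kaltonGraph k).dist n m : ℝ≥0)

/-- The shortest path metric of `strictKaltonGraph k` (a connected graph, see below). -/
noncomputable def strictKaltonDist (k : ℕ) (n m : IncTuple k) : ℝ≥0 :=
  ((strictKaltonGraph k).dist n m : ℝ≥0)

theorem strictKaltonGraph_le (k : ℕ) : strictKaltonGraph k ≤ kaltonGraph k := by
  intro n m h
  rw [strictKaltonGraph, SimpleGraph.fromRel_adj] at h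
  rw [kaltonGraph, SimpleGraph.fromRel_adj]
  refine ⟨h.1, h.2.imp (fun h => ⟨h.1, fun i j hij => (h.2 i j hij).le⟩)
    (fun h => ⟨h.1, fun i j hij => (h.2 i j hij).le⟩)⟩

theorem strictKaltonGraph_reachable_of_le {k : ℕ} (n N : IncTuple k)
    (hN : ∀ i j, n.1 i ≤ N.1 j) : (strictKaltonGraph k).Reachable n N := by
  -- replace the entries of `n` by those of `N`, starting from the last one
  let T : ℕ → IncTuple k := fun t => ⟨fun i => if (i : ℕ) < t then n.1 i else N.1 i, by
    intro i j hij
    have h1 := n.2 hij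
    have h2 := N.2 hij
    have h3 := hN i i
    have hij' : (i : ℕ) < j := hij
    dsimp only
    split_ifs
    · exact h1
    · exact lt_of_le_of_lt h3 h2
    · omega
    · exact h2⟩
  have hT : ∀ t, (strictKaltonGraph k).Reachable (T t) (T 0) := by
    intro t
    induction t with
    | zero => exact SimpleGraph.Reachable.refl _
    | succ t ih =>
      refine SimpleGraph.Reachable.trans ?_ ih
      by_cases he : T (t + 1) = T t
      · rw [he]
      · refine SimpleGraph.Adj.reachable ?_
        rw [strictKaltonGraph, SimpleGraph.fromRel_adj]
        refine ⟨he, Or.inl ⟨fun i => ?_, fun i j hij => ?_⟩⟩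
        · have h3 := hN i i
          change (if (i : ℕ) < t + 1 then n.1 i else N.1 i) ≤ (if (i : ℕ) < t then n.1 i else N.1 i)
          split_ifs <;> omega
        · have h1 := n.2 hij
          have h2 := N.2 hij
          have hij' : (i : ℕ) < j := hij
          change (if (i : ℕ) < t then n.1 i else N.1 i) < (if (j : ℕ) < t + 1 then n.1 j else N.1 j)
          have h3 := hN i i
          split_ifs <;> omega
  have h0 : T 0 = N := Subtype.ext (funext fun i => by simp [T])
  have hk : T k = n := Subtype.ext (funext fun i => by simp [T])
  rw [← h0]
  nth_rewrite 1 [← hk]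
  exact hT k

theorem strictKaltonGraph_connected (k : ℕ) : (strictKaltonGraph k).Connected := by
  have hne : Nonempty (IncTuple k) := ⟨⟨fun i => i, fun i j hij => hij⟩⟩
  refine { preconnected := fun n m => ?_, nonempty := hne }
  let N : IncTuple k := ⟨fun i => (∑ j, n.1 j) + (∑ j, m.1 j) + i, fun i j hij => by
    have hij' : (i : ℕ) < j := hij
    dsimp only
    omega⟩
  have hn : ∀ i j, n.1 i ≤ N.1 j := fun i j => by
    have := Finset.single_le_sum (f := n.1) (fun _ _ => Nat.zero_le _) (Finset.mem_univ i)
    change _ ≤ (∑ j, n.1 j) + (∑ j, m.1 j) + (j : ℕ)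
    omega
  have hm : ∀ i j, m.1 i ≤ N.1 j := fun i j => by
    have := Finset.single_le_sum (f := m.1) (fun _ _ => Nat.zero_le _) (Finset.mem_univ i)
    change _ ≤ (∑ j, n.1 j) + (∑ j, m.1 j) + (j : ℕ)
    omega
  exact (strictKaltonGraph_reachable_of_le n N hn).trans
    (strictKaltonGraph_reachable_of_le m N hm).symm

theorem kaltonGraph_connected (k : ℕ) : (kaltonGraph k).Connected :=
  (strictKaltonGraph_connected k).mono (strictKaltonGraph_le k)

/-! ## The James space -/

/-- `(∑_{j<k} (∑_{i ∈ I_j} a_i)²)^{1/2}` for the successive intervals `I_j = [p_j, p_{j+1})`. -/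
noncomputable def jamesSum (a : ℕ → ℝ) (k : ℕ) (p : ℕ → ℕ) : ℝ :=
  Real.sqrt (∑ j ∈ Finset.range k, (∑ i ∈ Finset.Ico (p j) (p (j + 1)), a i) ^ 2)

/-- The values of `jamesSum a` over all finite successions of intervals with no gaps in between
(empty intervals may occur and contribute `0`). -/
def jamesSums (a : ℕ → ℝ) : Set ℝ :=
  {s | ∃ (k : ℕ) (p : ℕ → ℕ), Monotone p ∧ s = jamesSum a k p}

theorem jamesSum_eq_norm (a : ℕ → ℝ) (k : ℕ) (p : ℕ → ℕ) :
    jamesSum a k p =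
      ‖WithLp.toLp 2 (fun j : Fin k => ∑ i ∈ Finset.Ico (p j) (p (j + 1)), a i)‖ := by
  rw [EuclideanSpace.norm_eq, jamesSum, Finset.sum_range]
  simp

theorem jamesSum_add_le (a b : ℕ → ℝ) (k : ℕ) (p : ℕ → ℕ) :
    jamesSum (a + b) k p ≤ jamesSum a k p + jamesSum b k p := by
  simp only [jamesSum_eq_norm]
  refine le_trans (le_of_eq ?_) (norm_add_le _ _)
  congr 1
  ext j
  simp [Finset.sum_add_distrib]

theorem jamesSum_smul (c : ℝ) (a : ℕ → ℝ) (k : ℕ) (p : ℕ → ℕ) :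
    jamesSum (c • a) k p = |c| * jamesSum a k p := by
  simp only [jamesSum_eq_norm]
  rw [← Real.norm_eq_abs, ← norm_smul]
  congr 1
  ext j
  simp [Finset.mul_sum]

theorem jamesSum_mem (a : ℕ → ℝ) (k : ℕ) {p : ℕ → ℕ} (hp : Monotone p) :
    jamesSum a k p ∈ jamesSums a := ⟨k, p, hp, rfl⟩

theorem jamesSums_nonempty (a : ℕ → ℝ) : (jamesSums a).Nonempty :=
  ⟨_, jamesSum_mem a 0 monotone_id⟩

theorem jamesSum_zero (k : ℕ) (p : ℕ → ℕ) : jamesSum 0 k p = 0 := by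
  simp [jamesSum]

/-- The real sequences `a` for which the supremum defining the James norm is finite. -/
def jamesSubmodule : Submodule ℝ (ℕ → ℝ) where
  carrier := {a | BddAbove (jamesSums a)}
  zero_mem' := ⟨0, by
    rintro _ ⟨k, p, -, rfl⟩
    exact (jamesSum_zero k p).le⟩
  add_mem' := by
    rintro a b ⟨A, hA⟩ ⟨B, hB⟩
    refine ⟨A + B, ?_⟩
    rintro _ ⟨k, p, hp, rfl⟩
    exact (jamesSum_add_le a b k p).trans
      (add_le_add (hA (jamesSum_mem a k hp)) (hB (jamesSum_mem b k hp)))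
  smul_mem' := by
    rintro c a ⟨A, hA⟩
    refine ⟨|c| * A, ?_⟩
    rintro _ ⟨k, p, hp, rfl⟩
    rw [jamesSum_smul]
    exact mul_le_mul_of_nonneg_left (hA (jamesSum_mem a k hp)) (abs_nonneg c)

/-- The James space `J`, written in coordinates with respect to its boundedly complete (summing)
basis `(e_i)`: since that basis is boundedly complete, `J` consists of all real sequences
`(a_i)` whose James norm is finite. -/
def JamesSpace : Type := jamesSubmodule

namespace JamesSpace

noncomputable instance : AddCommGroup JamesSpace := inferInstanceAs (AddCommGroup jamesSubmodule)

noncomputable instance : Module ℝ JamesSpace := inferInstanceAs (Module ℝ jamesSubmodule)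

/-- The coordinates `(a_i)` of `x = ∑ a_i e_i`. -/
def coord (x : JamesSpace) : ℕ → ℝ := Subtype.val x

/-- The James norm: `‖∑ a_i e_i‖ = sup (∑_j (∑_{i ∈ I_j} a_i)²)^{1/2}` over all finite successions
`I_1 < ⋯ < I_k` of intervals with no gaps in between. -/
noncomputable instance : Norm JamesSpace := ⟨fun x => sSup (jamesSums x.coord)⟩

theorem norm_def (x : JamesSpace) : ‖x‖ = sSup (jamesSums x.coord) := rfl

theorem jamesSum_le_norm (x : JamesSpace) (k : ℕ) {p : ℕ → ℕ} (hp : Monotone p) :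
    jamesSum x.coord k p ≤ ‖x‖ :=
  le_csSup x.2 (jamesSum_mem x.coord k hp)

theorem norm_le (x : JamesSpace) {C : ℝ} (h : ∀ k p, Monotone p → jamesSum x.coord k p ≤ C) :
    ‖x‖ ≤ C := by
  refine csSup_le (jamesSums_nonempty _) ?_
  rintro _ ⟨k, p, hp, rfl⟩
  exact h k p hp

theorem norm_smul_le' (c : ℝ) (x : JamesSpace) : ‖c • x‖ ≤ |c| * ‖x‖ :=
  norm_le _ fun k _ hp => (jamesSum_smul c x.coord k _).le.trans
    (mul_le_mul_of_nonneg_left (jamesSum_le_norm x k hp) (abs_nonneg c))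

theorem normCore : NormedSpace.Core ℝ JamesSpace where
  norm_nonneg x := (Real.sqrt_nonneg _).trans (jamesSum_le_norm x 0 monotone_id)
  norm_smul c x := by
    rw [Real.norm_eq_abs]
    refine le_antisymm (norm_smul_le' c x) ?_
    rcases eq_or_ne c 0 with rfl | hc
    · simpa using (Real.sqrt_nonneg _).trans (jamesSum_le_norm ((0 : ℝ) • x) 0 monotone_id)
    · have h := norm_smul_le' c⁻¹ (c • x)
      rw [inv_smul_smul₀ hc, abs_inv] at h
      have hc' : 0 < |c| := abs_pos.2 hc
      calc |c| * ‖x‖ ≤ |c| * (|c|⁻¹ * ‖c • x‖) := mul_le_mul_of_nonneg_left h hc'.le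
        _ = ‖c • x‖ := by field_simp
  norm_triangle x y := norm_le _ fun k p hp => (jamesSum_add_le x.coord y.coord k p).trans
    (add_le_add (jamesSum_le_norm x k hp) (jamesSum_le_norm y k hp))
  norm_eq_zero_iff x := by
    constructor
    · intro h
      refine Subtype.ext (funext fun i => ?_)
      have h1 := jamesSum_le_norm x 1 (p := fun j => i + j) (fun a b hab => by dsimp only; omega)
      rw [h] at h1
      have h2 : jamesSum x.coord 1 (fun j => i + j) = |x.coord i| := by
        simp [jamesSum, Real.sqrt_sq_eq_abs]
      rw [h2] at h1
      exact abs_eq_zero.1 (le_antisymm h1 (abs_nonneg _))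
    · rintro rfl
      refine le_antisymm (norm_le _ fun k p _ => (jamesSum_zero k p).le) ?_
      exact (Real.sqrt_nonneg _).trans (jamesSum_le_norm 0 0 monotone_id)

noncomputable instance : NormedAddCommGroup JamesSpace := NormedAddCommGroup.ofCore normCore

noncomputable instance : NormedSpace ℝ JamesSpace := NormedSpace.ofCore normCore

end JamesSpace

/-! ## Quadratic variation and the James norm -/

/-! Let `f` map `k`-tuples to `J`, with `k = r * r`, and move interlacing pairs by at most `L`.
Coordinatewise limits along an ultrafilter, taken in one entry after another from the last
backwards, write `f` as its full limit plus `k` increments (`branch`, `incr`). Each increment is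
coordinatewise null in its newest entry, so that entry can be chosen to make it almost a block
beyond everything chosen before.

Successive blocks in `J` satisfy a lower 2-estimate (`norm_sq_add_norm_sq_le`). On a suitable
interlacing pair this bounds the sum of the squared asymptotic norms of the increments by a constant
`A` depending only on `L` (`sum_limSq_le`). Hence some `r` successive levels carry at most `A / r`,
and by Cauchy–Schwarz the norms of the increments there add up to about `√A` at most: all `r`
entries can be changed at bounded cost.

After these levels both tuples continue with the same entries. There is no upper 2-estimate for
general blocks, since coordinate sums may accumulate, but the two new increments have almost the
same sum, so their difference is almost a block of sum zero. Such blocks do satisfy an upper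
2-estimate (`EndBound.add`), and the remaining levels also cost a bounded amount
(`exists_common_extension`). The resulting tuples are at graph distance at least `r`
(`le_dist_of_forall_lt`), while their images stay within a bound depending only on `L`; letting `r →
∞` contradicts `ρ → ∞`. -/

/-- The quadratic variation of `b` along the points `p 0, …, p l`. -/
def quadVar (b : ℕ → ℝ) (l : ℕ) (p : ℕ → ℕ) : ℝ :=
  ∑ j ∈ Finset.range l, (b (p (j + 1)) - b (p j)) ^ 2

theorem quadVar_nonneg (b : ℕ → ℝ) (l : ℕ) (p : ℕ → ℕ) : 0 ≤ quadVar b l p :=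
  Finset.sum_nonneg fun _ _ => sq_nonneg _

theorem quadVar_zero (b : ℕ → ℝ) (p : ℕ → ℕ) : quadVar b 0 p = 0 := by simp [quadVar]

theorem quadVar_succ (b : ℕ → ℝ) (l : ℕ) (p : ℕ → ℕ) :
    quadVar b (l + 1) p = quadVar b l p + (b (p (l + 1)) - b (p l)) ^ 2 := by
  simp [quadVar, Finset.sum_range_succ]

theorem quadVar_congr {b b' : ℕ → ℝ} {l : ℕ} {p p' : ℕ → ℕ}
    (h : ∀ j ≤ l, b (p j) = b' (p' j)) : quadVar b l p = quadVar b' l p' := by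
  refine Finset.sum_congr rfl fun j hj => ?_
  have hj' := Finset.mem_range.1 hj
  rw [h j hj'.le, h (j + 1) hj']

/-- The partial sums of a sequence. -/
def partialSum (a : ℕ → ℝ) (p : ℕ) : ℝ := ∑ i ∈ Finset.range p, a i

theorem jamesSum_eq_sqrt_quadVar (a : ℕ → ℝ) (l : ℕ) {p : ℕ → ℕ} (hp : Monotone p) :
    jamesSum a l p = Real.sqrt (quadVar (partialSum a) l p) := by
  unfold jamesSum quadVar partialSum
  congr 1
  refine Finset.sum_congr rfl fun j _ => ?_
  rw [Finset.sum_Ico_eq_sub _ (hp (Nat.le_succ j))]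

/-! ### The James norm through paths of partial sums. -/

namespace JamesSpace

/-- The partial sums of the coordinates. -/
def path (x : JamesSpace) (p : ℕ) : ℝ := partialSum x.coord p

@[simp] theorem coord_add (x y : JamesSpace) (i : ℕ) : (x + y).coord i = x.coord i + y.coord i := rfl
@[simp] theorem coord_sub (x y : JamesSpace) (i : ℕ) : (x - y).coord i = x.coord i - y.coord i := rfl
@[simp] theorem coord_smul (c : ℝ) (x : JamesSpace) (i : ℕ) : (c • x).coord i = c * x.coord i := rfl
@[simp] theorem coord_zero (i : ℕ) : (0 : JamesSpace).coord i = 0 := rfl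

theorem ext_coord {x y : JamesSpace} (h : ∀ i, x.coord i = y.coord i) : x = y :=
  Subtype.ext (funext h)

theorem path_zero_right (x : JamesSpace) : x.path 0 = 0 := by simp [path, partialSum]

theorem path_add (x y : JamesSpace) (p : ℕ) : (x + y).path p = x.path p + y.path p := by
  simp [path, partialSum, Finset.sum_add_distrib]

theorem path_sub (x y : JamesSpace) (p : ℕ) : (x - y).path p = x.path p - y.path p := by
  simp [path, partialSum, Finset.sum_sub_distrib]

theorem path_smul (c : ℝ) (x : JamesSpace) (p : ℕ) : (c • x).path p = c * x.path p := by
  simp [path, partialSum, Finset.mul_sum]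

theorem quadVar_path_le (x : JamesSpace) (l : ℕ) {p : ℕ → ℕ} (hp : Monotone p) :
    quadVar x.path l p ≤ ‖x‖ ^ 2 := by
  have h := jamesSum_le_norm x l hp
  rw [jamesSum_eq_sqrt_quadVar _ _ hp] at h
  exact (Real.sqrt_le_left (norm_nonneg x)).1 h

theorem norm_sq_le {x : JamesSpace} {B : ℝ}
    (h : ∀ l p, Monotone p → quadVar x.path l p ≤ B) : ‖x‖ ^ 2 ≤ B := by
  have hB : 0 ≤ B := by simpa [quadVar_zero] using h 0 id monotone_id
  have h1 : ‖x‖ ≤ Real.sqrt B := norm_le x fun l p hp => by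
    rw [jamesSum_eq_sqrt_quadVar _ _ hp]
    exact Real.sqrt_le_sqrt (h l p hp)
  calc ‖x‖ ^ 2 ≤ Real.sqrt B ^ 2 := by gcongr
    _ = B := Real.sq_sqrt hB

/-- A sequence of bounded quadratic variation, as an element of the James space. -/
def ofBound (a : ℕ → ℝ) (B : ℝ)
    (h : ∀ l p, Monotone p → quadVar (partialSum a) l p ≤ B) : JamesSpace :=
  ⟨a, by
    refine ⟨Real.sqrt B, ?_⟩
    rintro _ ⟨l, p, hp, rfl⟩
    rw [jamesSum_eq_sqrt_quadVar _ _ hp]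
    exact Real.sqrt_le_sqrt (h l p hp)⟩

@[simp] theorem coord_ofBound (a : ℕ → ℝ) (B : ℝ)
    (h : ∀ l p, Monotone p → quadVar (partialSum a) l p ≤ B) : (ofBound a B h).coord = a := rfl

theorem norm_sq_ofBound_le (a : ℕ → ℝ) (B : ℝ)
    (h : ∀ l p, Monotone p → quadVar (partialSum a) l p ≤ B) : ‖ofBound a B h‖ ^ 2 ≤ B :=
  norm_sq_le h

theorem abs_path_sub_le (x : JamesSpace) {p q : ℕ} (h : p ≤ q) : |x.path q - x.path p| ≤ ‖x‖ := by
  have h1 := quadVar_path_le x 1 (p := fun j => if j = 0 then p else q) (by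
    intro a b hab
    dsimp only
    split_ifs <;> omega)
  simp only [quadVar, Finset.sum_range_one] at h1
  exact abs_le_of_sq_le_sq (by simpa using h1) (norm_nonneg x)

theorem abs_path_le (x : JamesSpace) (p : ℕ) : |x.path p| ≤ ‖x‖ := by
  simpa [path_zero_right] using abs_path_sub_le x (Nat.zero_le p)

theorem coord_eq_path_sub (x : JamesSpace) (i : ℕ) : x.coord i = x.path (i + 1) - x.path i := by
  simp [path, partialSum, Finset.sum_range_succ]

theorem abs_coord_le (x : JamesSpace) (i : ℕ) : |x.coord i| ≤ ‖x‖ := by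
  rw [coord_eq_path_sub]
  exact abs_path_sub_le x (Nat.le_succ i)

/-- Quadratic variations over successive ranges add up. -/
theorem quadVar_add_quadVar_le (x : JamesSpace) (l m : ℕ) {p q : ℕ → ℕ} (hp : Monotone p)
    (hq : Monotone q) (hpq : p l ≤ q 0) :
    quadVar x.path l p + quadVar x.path m q ≤ ‖x‖ ^ 2 := by
  -- Concatenate the two partitions; the increment joining `p l` to `q 0` is one extra square,
  -- dropped at the end.
  let r : ℕ → ℕ := fun j => if j ≤ l then p j else q (j - (l + 1))
  have hr : Monotone r := by
    intro a b hab
    dsimp only [r]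
    split_ifs with h1 h2
    · exact hp hab
    · exact (hp h1).trans (hpq.trans (hq (Nat.zero_le _)))
    · omega
    · exact hq (by omega)
  have h := quadVar_path_le x (l + 1 + m) hr
  have h1 : quadVar x.path l p = quadVar x.path l r :=
    quadVar_congr fun j hj => by simp [r, hj]
  have h2 : quadVar x.path m q = quadVar x.path m (fun j => r (l + 1 + j)) :=
    quadVar_congr fun j _ => by
      have : ¬ (l + 1 + j ≤ l) := by omega
      simp [r, this]
  have h3 : quadVar x.path (l + 1 + m) r =
      quadVar x.path (l + 1) r + quadVar x.path m (fun j => r (l + 1 + j)) := by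
    rw [quadVar, Finset.sum_range_add]; rfl
  rw [h3, quadVar_succ] at h
  rw [h1, h2]
  linarith [sq_nonneg (x.path (r (l + 1)) - x.path (r l))]

theorem partialSum_indicator_Ici (x : JamesSpace) (N p : ℕ) :
    partialSum (fun i => if N ≤ i then x.coord i else 0) p = x.path (max N p) - x.path N := by
  induction p with
  | zero => simp [partialSum]
  | succ p ih =>
    rw [partialSum, Finset.sum_range_succ, ← partialSum, ih]
    split_ifs with hp
    · have h1 : max N p = p := by omega
      have h2 : max N (p + 1) = p + 1 := by omega
      rw [h1, h2, coord_eq_path_sub]; ring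
    · have h1 : max N (p + 1) = max N p := by omega
      rw [h1, add_zero]

theorem quadVar_indicator_Ici (x : JamesSpace) (N l : ℕ) (p : ℕ → ℕ) :
    quadVar (partialSum fun i => if N ≤ i then x.coord i else 0) l p =
      quadVar x.path l (fun j => max N (p j)) := by
  simp only [quadVar, partialSum_indicator_Ici]
  exact Finset.sum_congr rfl fun j _ => by ring

/-- The restriction of `x` to the coordinates `≥ N`. -/
noncomputable def tail (N : ℕ) (x : JamesSpace) : JamesSpace :=
  ofBound (fun i => if N ≤ i then x.coord i else 0) (‖x‖ ^ 2) fun l p hp => by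
    rw [quadVar_indicator_Ici]
    exact quadVar_path_le x l fun a b hab => max_le_max le_rfl (hp hab)

theorem coord_tail (N : ℕ) (x : JamesSpace) (i : ℕ) :
    (tail N x).coord i = if N ≤ i then x.coord i else 0 := rfl

theorem quadVar_tail (x : JamesSpace) (N l : ℕ) (p : ℕ → ℕ) :
    quadVar (tail N x).path l p = quadVar x.path l (fun j => max N (p j)) :=
  quadVar_indicator_Ici x N l p

/-- The tails of `x` tend to `0` in norm. -/
theorem exists_norm_tail_le (x : JamesSpace) {δ : ℝ} (hδ : 0 < δ) : ∃ N, ‖tail N x‖ ≤ δ := by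
  -- For a nearly optimal partition, any variation beyond its last point would add to it, so at most
  -- `δ ^ 2` is left there.
  obtain ⟨l, p, hp, h⟩ : ∃ l p, Monotone p ∧ ‖x‖ ^ 2 - δ ^ 2 < quadVar x.path l p := by
    by_contra! hc
    have := norm_sq_le hc
    have := pow_pos hδ 2
    linarith
  refine ⟨p l, ?_⟩
  refine (sq_le_sq₀ (norm_nonneg _) hδ.le).1 ?_
  refine norm_sq_le fun m q hq => ?_
  rw [quadVar_tail]
  have := quadVar_add_quadVar_le x l m hp (q := fun j => max (p l) (q j))
    (fun a b hab => max_le_max le_rfl (hq hab)) (le_max_left _ _)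
  linarith

/-- The unit vectors. -/
def unit (N : ℕ) : JamesSpace :=
  ofBound (Pi.single N 1) 1 fun l p hp => by
    have key : ∀ q, partialSum (Pi.single N (1 : ℝ)) q = if N < q then 1 else 0 := fun q => by
      simp [partialSum]
    -- Sharper than the bound 1, so that the induction closes: before the jump the variation is
    -- still 0.
    have : ∀ l, quadVar (partialSum (Pi.single N (1 : ℝ))) l p ≤ if N < p l then 1 else 0 := by
      intro l
      induction l with
      | zero => rw [quadVar_zero]; split_ifs <;> norm_num
      | succ l ih =>
        have := hp (Nat.le_succ l)
        rw [quadVar_succ, key, key]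
        split_ifs at ih ⊢ <;> first | omega | (norm_num; linarith)
    refine (this l).trans ?_
    split_ifs <;> norm_num

theorem coord_unit (N i : ℕ) : (unit N).coord i = if i = N then 1 else 0 := by
  change (Pi.single N (1 : ℝ) : ℕ → ℝ) i = _
  rw [Pi.single_apply]

theorem norm_unit_le (N : ℕ) : ‖unit N‖ ≤ 1 := by
  have h : ‖unit N‖ ^ 2 ≤ 1 := norm_sq_ofBound_le _ _ _
  exact (sq_le_one_iff₀ (norm_nonneg _)).1 h

/-- `x` without its tail is a finite combination of unit vectors. -/
theorem sub_tail_eq_sum (N : ℕ) (x : JamesSpace) :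
    x - tail N x = ∑ i ∈ Finset.range N, x.coord i • unit i := by
  refine ext_coord fun i => ?_
  have h : ∀ M, (∑ i ∈ Finset.range M, x.coord i • unit i).coord i = if i < M then x.coord i else 0 := by
    intro M
    induction M with
    | zero => simp
    | succ M ih =>
      rw [Finset.sum_range_succ, coord_add, ih, coord_smul, coord_unit]
      split_ifs <;> first | omega | simp_all
  rw [h, coord_sub, coord_tail]
  split_ifs <;> first | omega | simp

theorem norm_sub_tail_le (N : ℕ) (x : JamesSpace) :
    ‖x - tail N x‖ ≤ ∑ i ∈ Finset.range N, |x.coord i| := by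
  rw [sub_tail_eq_sum]
  refine (norm_sum_le _ _).trans (Finset.sum_le_sum fun i _ => ?_)
  rw [norm_smul, Real.norm_eq_abs]
  exact mul_le_of_le_one_right (abs_nonneg _) (norm_unit_le i)

theorem norm_tail_le (N : ℕ) (x : JamesSpace) : ‖tail N x‖ ≤ ‖x‖ := by
  refine (sq_le_sq₀ (norm_nonneg _) (norm_nonneg _)).1 ?_
  exact norm_sq_ofBound_le _ _ _

/-! ## Vectors supported before or after an index -/

/-- All coordinates from `N` on vanish. -/
def SuppLT (x : JamesSpace) (N : ℕ) : Prop := ∀ i, N ≤ i → x.coord i = 0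

/-- All coordinates before `N` vanish. -/
def SuppGE (x : JamesSpace) (N : ℕ) : Prop := ∀ i, i < N → x.coord i = 0

theorem SuppLT.mono {x : JamesSpace} {N M : ℕ} (h : SuppLT x N) (hNM : N ≤ M) : SuppLT x M :=
  fun i hi => h i (hNM.trans hi)

theorem SuppLT.add {x y : JamesSpace} {N : ℕ} (hx : SuppLT x N) (hy : SuppLT y N) :
    SuppLT (x + y) N := fun i hi => by rw [coord_add, hx i hi, hy i hi, add_zero]

theorem SuppLT.neg {x : JamesSpace} {N : ℕ} (hx : SuppLT x N) : SuppLT (-x) N := fun i hi => by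
  rw [← zero_sub, coord_sub, hx i hi, coord_zero, sub_zero]

theorem SuppGE.neg {x : JamesSpace} {N : ℕ} (hx : SuppGE x N) : SuppGE (-x) N := fun i hi => by
  rw [← zero_sub, coord_sub, hx i hi, coord_zero, sub_zero]

theorem SuppLT.path_eq {x : JamesSpace} {N p : ℕ} (hx : SuppLT x N) (hp : N ≤ p) :
    x.path p = x.path N := by
  refine (Finset.sum_subset (Finset.range_mono hp) fun i _ hi => hx i ?_).symm
  simpa using hi

theorem SuppGE.path_eq {x : JamesSpace} {N p : ℕ} (hx : SuppGE x N) (hp : p ≤ N) :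
    x.path p = 0 :=
  Finset.sum_eq_zero fun i hi => hx i ((Finset.mem_range.1 hi).trans_le hp)

/-- Cap a partition for `w` at `N` and start one for `v` at `N`: together they partition for `w +
v`, and on each piece only one summand varies. The two suprema can then be taken separately. -/
theorem norm_sq_add_norm_sq_le {w v : JamesSpace} {N : ℕ} (hw : SuppLT w N) (hv : SuppGE v N) :
    ‖w‖ ^ 2 + ‖v‖ ^ 2 ≤ ‖w + v‖ ^ 2 := by
  have key : ∀ l p m q, Monotone p → Monotone q →
      quadVar w.path l p + quadVar v.path m q ≤ ‖w + v‖ ^ 2 := by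
    intro l p m q hp hq
    have h := quadVar_add_quadVar_le (w + v) l m (p := fun j => min (p j) N)
      (q := fun j => max N (q j)) (fun a b hab => min_le_min (hp hab) le_rfl)
      (fun a b hab => max_le_max le_rfl (hq hab)) ((min_le_right _ _).trans (le_max_left _ _))
    have h1 : quadVar (w + v).path l (fun j => min (p j) N) = quadVar w.path l p :=
      quadVar_congr fun j _ => by
        rw [path_add, hv.path_eq (min_le_right _ _), add_zero]
        rcases le_total (p j) N with h | h
        · rw [min_eq_left h]
        · rw [min_eq_right h, hw.path_eq h]
    have h2 : quadVar (w + v).path m (fun j => max N (q j)) = quadVar v.path m q := by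
      refine Finset.sum_congr rfl fun j _ => ?_
      have h3 : ∀ i, (w + v).path (max N (q i)) = w.path N + v.path (q i) := fun i => by
        rw [path_add, hw.path_eq (le_max_left _ _)]
        rcases le_total (q i) N with h | h
        · rw [max_eq_left h, hv.path_eq h, hv.path_eq le_rfl]
        · rw [max_eq_right h]
      rw [h3, h3]; ring
    linarith
  have h1 : ∀ m q, Monotone q → ‖w‖ ^ 2 ≤ ‖w + v‖ ^ 2 - quadVar v.path m q := fun m q hq =>
    norm_sq_le fun l p hp => by linarith [key l p m q hp hq]
  have h2 : ‖v‖ ^ 2 ≤ ‖w + v‖ ^ 2 - ‖w‖ ^ 2 := norm_sq_le fun m q hq => by linarith [h1 m q hq]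
  linarith

/-- An upper bound for the variant of the squared James norm of a vector supported before `N`
in which the last increment counts twice. -/
def EndBound (w : JamesSpace) (N : ℕ) (B : ℝ) : Prop :=
  ∀ l p, Monotone p → p l ≤ N → quadVar w.path l p + 2 * (w.path N - w.path (p l)) ^ 2 ≤ B

theorem quadVar_add_sq_le (x : JamesSpace) (l : ℕ) {p : ℕ → ℕ} (hp : Monotone p) {N : ℕ}
    (hN : p l ≤ N) : quadVar x.path l p + (x.path N - x.path (p l)) ^ 2 ≤ ‖x‖ ^ 2 := by
  have h := quadVar_path_le x (l + 1) (p := fun j => if j ≤ l then p j else N) (by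
    intro a b hab
    dsimp only
    split_ifs with h1 h2
    · exact hp hab
    · exact (hp h1).trans hN
    · omega
    · exact le_rfl)
  rw [quadVar_succ] at h
  have h1 : quadVar x.path l (fun j => if j ≤ l then p j else N) = quadVar x.path l p :=
    quadVar_congr fun j hj => by simp [hj]
  rw [h1] at h
  simpa using h

theorem endBound_two_mul_norm_sq (w : JamesSpace) (N : ℕ) : EndBound w N (2 * ‖w‖ ^ 2) := by
  intro l p hp hN
  have := quadVar_add_sq_le w l hp hN
  have := quadVar_nonneg w.path l p
  linarith

theorem EndBound.mono {w : JamesSpace} {N : ℕ} {B B' : ℝ} (h : EndBound w N B) (hB : B ≤ B') :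
    EndBound w N B' := fun l p hp hN => (h l p hp hN).trans hB

theorem EndBound.norm_sq_le {w : JamesSpace} {N : ℕ} {B : ℝ} (h : EndBound w N B)
    (hw : SuppLT w N) : ‖w‖ ^ 2 ≤ B :=
  JamesSpace.norm_sq_le fun l p hp => by
    have h1 := h l (fun j => min (p j) N) (fun a b hab => min_le_min (hp hab) le_rfl)
      (min_le_right _ _)
    have h2 : quadVar w.path l (fun j => min (p j) N) = quadVar w.path l p :=
      quadVar_congr fun j _ => by
        rcases le_total (p j) N with h | h
        · rw [min_eq_left h]
        · rw [min_eq_right h, hw.path_eq h]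
    rw [h2] at h1
    linarith [sq_nonneg (w.path N - w.path (min (p l) N))]

/-- Adding a block of sum zero after the support of `w`. -/
theorem EndBound.add {w v : JamesSpace} {N M : ℕ} {B : ℝ} (h : EndBound w N B)
    (hw : SuppLT w N) (hv : SuppGE v N) (hNM : N ≤ M) (hv0 : v.path M = 0) :
    EndBound (w + v) M (B + 2 * ‖v‖ ^ 2) := by
  have hB : 0 ≤ B := by
    have := h 0 (fun _ => N) monotone_const le_rfl
    simpa [quadVar_zero] using this
  intro l p hp hM
  have low : ∀ l, p l < N → quadVar (w + v).path l p = quadVar w.path l p := fun l hl =>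
    quadVar_congr fun j hj => by
      rw [path_add, hv.path_eq ((hp hj).trans hl.le), add_zero]
  have high : ∀ l, N ≤ p l → quadVar (w + v).path l p ≤ B + 2 * quadVar v.path l p := by
    intro l
    induction l with
    | zero => intro _; simpa [quadVar_zero] using hB
    | succ l ih =>
      intro hl
      rw [quadVar_succ, quadVar_succ, path_add, path_add, hw.path_eq hl]
      rcases le_or_gt N (p l) with h1 | h1
      · have := ih h1
        rw [hw.path_eq h1]
        nlinarith [sq_nonneg (v.path (p (l + 1)) - v.path (p l))]
      -- The increment across `N` is one of `w` ending at `N` plus one of `v`. By `(a + b)² ≤ 2a² +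
      -- 2b²` it is absorbed by the end increment of `w`, which `EndBound` counts twice.
      · rw [low l h1]
        have h2 := h l p hp h1.le
        have h3 := quadVar_nonneg v.path l p
        nlinarith [sq_nonneg ((w.path N - w.path (p l)) - (v.path (p (l + 1)) - v.path (p l)))]
  -- Since `v` has sum zero, the path of `w + v` is back at `w.path N` at `M`; this is what lets the
  -- bound be iterated.
  rw [path_add, path_add, hv0, hw.path_eq hNM]
  rcases le_or_gt N (p l) with h1 | h1
  · have h2 := high l h1
    have h3 := quadVar_add_sq_le v l hp hM
    rw [hv0] at h3
    rw [hw.path_eq h1]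
    nlinarith
  · rw [low l h1, hv.path_eq h1.le]
    have := h l p hp h1.le
    simp only [add_zero]
    linarith [sq_nonneg ‖v‖]

end JamesSpace

/-! ## Limits along an ultrafilter -/

/-- The limit of a bounded real sequence along a fixed nonprincipal ultrafilter. -/
noncomputable def ulim (F : ℕ → ℝ) : ℝ := limUnder (hyperfilter ℕ : Filter ℕ) F

theorem tendsto_ulim_of_mem_Icc {F : ℕ → ℝ} {a b : ℝ} (h : ∀ n, F n ∈ Set.Icc a b) :
    Tendsto F (hyperfilter ℕ) (nhds (ulim F)) ∧ ulim F ∈ Set.Icc a b := by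
  obtain ⟨x, hx, hle⟩ := (isCompact_Icc (a := a) (b := b)).ultrafilter_le_nhds
    ((hyperfilter ℕ).map F) (le_principal_iff.2 (mem_map.2 (univ_mem' h)))
  have ht : Tendsto F (hyperfilter ℕ) (nhds x) := hle
  have he : ulim F = x := ht.limUnder_eq
  rw [he]
  exact ⟨ht, hx⟩

theorem tendsto_ulim {F : ℕ → ℝ} {C : ℝ} (h : ∀ n, |F n| ≤ C) :
    Tendsto F (hyperfilter ℕ) (nhds (ulim F)) :=
  (tendsto_ulim_of_mem_Icc fun n => abs_le.1 (h n)).1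

/-! ### Coordinate sums, and perturbation of null sequences to blocks. -/

namespace JamesSpace

/-- The sum of all coordinates. -/
noncomputable def total (x : JamesSpace) : ℝ := ulim x.path

theorem tendsto_path_total (x : JamesSpace) :
    Tendsto x.path (hyperfilter ℕ) (nhds x.total) :=
  tendsto_ulim (abs_path_le x)

theorem total_sub (x y : JamesSpace) : (x - y).total = x.total - y.total := by
  refine tendsto_nhds_unique (tendsto_path_total _) ?_
  refine ((tendsto_path_total x).sub (tendsto_path_total y)).congr fun p => ?_
  rw [path_sub]

theorem abs_total_le (x : JamesSpace) : |x.total| ≤ ‖x‖ :=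
  le_of_tendsto (tendsto_path_total x).abs (Eventually.of_forall (abs_path_le x))

theorem SuppLT.total_eq {x : JamesSpace} {N : ℕ} (hx : SuppLT x N) : x.total = x.path N := by
  refine tendsto_nhds_unique (tendsto_path_total x) (tendsto_const_nhds.congr' ?_)
  exact Nat.hyperfilter_le_atTop ((eventually_ge_atTop N).mono fun p hp => (hx.path_eq hp).symm)

theorem suppLT_sub_tail (N : ℕ) (x : JamesSpace) : SuppLT (x - tail N x) N := fun i hi => by
  rw [coord_sub, coord_tail, if_pos hi, sub_self]

/-- A vector is close to a finitely supported one. -/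
theorem exists_suppLT (x : JamesSpace) {δ : ℝ} (hδ : 0 < δ) :
    ∃ w N, SuppLT w N ∧ ‖x - w‖ ≤ δ ∧ ‖w‖ ≤ ‖x‖ + δ := by
  obtain ⟨N, hN⟩ := exists_norm_tail_le x hδ
  refine ⟨x - tail N x, N, suppLT_sub_tail N x, by simpa using hN, ?_⟩
  exact (norm_sub_le _ _).trans (by linarith)

/-- A coordinatewise null sequence eventually consists of perturbations of blocks. -/
theorem eventually_exists_block {u : ℕ → JamesSpace}
    (hu : ∀ i, Tendsto (fun n => (u n).coord i) (hyperfilter ℕ) (nhds 0)) (N : ℕ) {κ : ℝ}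
    (hκ : 0 < κ) : ∀ᶠ n in (hyperfilter ℕ : Filter ℕ), ∃ v M, N ≤ M ∧ SuppGE v N ∧ SuppLT v M ∧
      ‖u n - v‖ ≤ κ := by
  have h : Tendsto (fun n => ∑ i ∈ Finset.range N, |(u n).coord i|) (hyperfilter ℕ) (nhds 0) := by
    have := tendsto_finsetSum (Finset.range N) fun i _ => (hu i).abs
    simpa using this
  filter_upwards [h.eventually (ge_mem_nhds (half_pos hκ))] with n hn
  obtain ⟨w, M, hw, h1, -⟩ := exists_suppLT (tail N (u n)) (half_pos hκ)
  -- Cutting `w` at `N` restores the lower support condition at no cost, as `tail N` is contractive.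
  refine ⟨tail N w, max N M, le_max_left _ _, ?_, ?_, ?_⟩
  · intro i hi
    rw [coord_tail, if_neg (by omega)]
  · intro i hi
    rw [coord_tail, hw i ((le_max_right _ _).trans hi), ite_self]
  · have h2 : tail N (tail N (u n) - w) = tail N (u n) - tail N w := ext_coord fun i => by
      simp only [coord_tail, coord_sub]
      split_ifs <;> simp
    have h3 : u n - tail N w = (u n - tail N (u n)) + tail N (tail N (u n) - w) := by
      rw [h2]; abel
    rw [h3]
    have h4 := norm_tail_le N (tail N (u n) - w)
    have h5 := norm_sub_tail_le N (u n)
    refine (norm_add_le _ _).trans ?_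
    linarith

/-- A vector of almost vanishing sum close to a block is close to a block of sum zero. -/
theorem exists_block_sum_zero {u v : JamesSpace} {N M : ℕ} {κ : ℝ} (hNM : N ≤ M)
    (hv : SuppGE v N) (hv' : SuppLT v M) (huv : ‖u - v‖ ≤ κ) (hu : |u.total| ≤ κ) :
    ∃ v' M', N ≤ M' ∧ SuppGE v' N ∧ SuppLT v' M' ∧ v'.path M' = 0 ∧ ‖u - v'‖ ≤ 3 * κ := by
  have hs : SuppLT (unit M) (M + 1) := fun i hi => by
    rw [coord_unit, if_neg (by omega)]
  have hM : (unit M).path (M + 1) = 1 := by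
    have h1 := coord_eq_path_sub (unit M) M
    have h2 : SuppGE (unit M) M := fun i hi => by rw [coord_unit, if_neg (by omega)]
    rw [h2.path_eq le_rfl, coord_unit, if_pos rfl] at h1
    linarith
  -- A multiple of the unit vector just after the block cancels its sum, which is at most `2 * κ`:
  -- `κ` for `u` and `κ` for `u - v`.
  refine ⟨v - v.path M • unit M, M + 1, by omega, ?_, ?_, ?_, ?_⟩
  · intro i hi
    rw [coord_sub, coord_smul, coord_unit, if_neg (by omega), hv i hi]; simp
  · intro i hi
    rw [coord_sub, coord_smul, coord_unit, if_neg (by omega), hv' i (by omega)]; simp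
  · rw [path_sub, path_smul, hM, hv'.path_eq (Nat.le_succ M)]; simp
  · have h1 : |v.path M| ≤ 2 * κ := by
      have h2 := abs_total_le (u - v)
      rw [total_sub] at h2
      rw [← hv'.total_eq]
      have h3 := abs_sub_abs_le_abs_sub v.total u.total
      rw [abs_sub_comm] at h3
      linarith
    have h4 : ‖v.path M • unit M‖ ≤ 2 * κ := by
      rw [norm_smul, Real.norm_eq_abs]
      exact (mul_le_of_le_one_right (abs_nonneg _) (norm_unit_le M)).trans h1
    have h5 : u - (v - v.path M • unit M) = (u - v) + v.path M • unit M := by abel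
    rw [h5]
    refine (norm_add_le _ _).trans ?_
    linarith

/-! ## Coordinatewise limits of bounded sequences -/

theorem tendsto_partialSum_ulim {x : ℕ → JamesSpace} {C : ℝ} (h : ∀ n, ‖x n‖ ≤ C) (p : ℕ) :
    Tendsto (fun n => (x n).path p) (hyperfilter ℕ)
      (nhds (partialSum (fun i => ulim fun n => (x n).coord i) p)) :=
  tendsto_finsetSum _ fun i _ => tendsto_ulim fun n => (abs_coord_le (x n) i).trans (h n)

/-- A fixed quadratic variation involves finitely many coordinates, so it passes to the limit: the
norm is lower semicontinuous for coordinatewise convergence. -/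
theorem quadVar_ulim_le {x : ℕ → JamesSpace} {C : ℝ} (h : ∀ n, ‖x n‖ ≤ C) (l : ℕ) {p : ℕ → ℕ}
    (hp : Monotone p) :
    quadVar (partialSum fun i => ulim fun n => (x n).coord i) l p ≤ C ^ 2 := by
  have ht : Tendsto (fun n => quadVar (x n).path l p) (hyperfilter ℕ)
      (nhds (quadVar (partialSum fun i => ulim fun n => (x n).coord i) l p)) :=
    tendsto_finsetSum _ fun j _ =>
      ((tendsto_partialSum_ulim h _).sub (tendsto_partialSum_ulim h _)).pow 2
  refine le_of_tendsto ht (Eventually.of_forall fun n => ?_)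
  refine (quadVar_path_le (x n) l hp).trans ?_
  have := norm_nonneg (x n)
  gcongr
  exact h n

open Classical in
/-- The coordinatewise limit of a bounded sequence along the ultrafilter. -/
noncomputable def wlim (x : ℕ → JamesSpace) : JamesSpace :=
  if h : ∃ C, ∀ n, ‖x n‖ ≤ C then
    ofBound (fun i => ulim fun n => (x n).coord i) (h.choose ^ 2)
      fun l _ hp => quadVar_ulim_le h.choose_spec l hp
  else 0

theorem coord_wlim {x : ℕ → JamesSpace} {C : ℝ} (h : ∀ n, ‖x n‖ ≤ C) (i : ℕ) :
    (wlim x).coord i = ulim fun n => (x n).coord i := by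
  rw [wlim, dif_pos ⟨C, h⟩, coord_ofBound]

theorem tendsto_coord_wlim {x : ℕ → JamesSpace} {C : ℝ} (h : ∀ n, ‖x n‖ ≤ C) (i : ℕ) :
    Tendsto (fun n => (x n).coord i) (hyperfilter ℕ) (nhds ((wlim x).coord i)) := by
  rw [coord_wlim h]
  exact tendsto_ulim fun n => (abs_coord_le (x n) i).trans (h n)

theorem norm_wlim_le {x : ℕ → JamesSpace} {C : ℝ} (h : ∀ n, ‖x n‖ ≤ C) : ‖wlim x‖ ≤ C := by
  have hC : 0 ≤ C := (norm_nonneg _).trans (h 0)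
  refine (sq_le_sq₀ (norm_nonneg _) hC).1 (JamesSpace.norm_sq_le fun l p hp => ?_)
  have he : (wlim x).path = partialSum fun i => ulim fun n => (x n).coord i := by
    funext q
    simp only [path, partialSum, coord_wlim h]
  rw [he]
  exact quadVar_ulim_le h l hp

end JamesSpace

/-! ## Iterated limits of functions of a tuple -/

/-- The limit of `F`, a function of the entries `t 0, …, t (k - 1)`, in the last `d` of them. -/
def limTower {E : Type*} (lim : (ℕ → E) → E) (F : (ℕ → ℕ) → E) (k : ℕ) : ℕ → (ℕ → ℕ) → E
  | 0, t => F t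
  | d + 1, t => lim fun n => limTower lim F k d (Function.update t (k - (d + 1)) n)

/-- The limit of `F`, a function of the entries `t 0, …, t (k - 1)`, in the entries from the
`i`-th on. -/
def limFrom {E : Type*} (lim : (ℕ → E) → E) (k : ℕ) (F : (ℕ → ℕ) → E) (i : ℕ) (t : ℕ → ℕ) : E :=
  limTower lim F k (k - i) t

section limFrom

variable {E : Type*} (lim : (ℕ → E) → E)

theorem limFrom_self (k : ℕ) (F : (ℕ → ℕ) → E) (t : ℕ → ℕ) : limFrom lim k F k t = F t := by
  simp [limFrom, limTower]

theorem limFrom_of_lt {k i : ℕ} (hi : i < k) (F : (ℕ → ℕ) → E) (t : ℕ → ℕ) :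
    limFrom lim k F i t = lim fun n => limFrom lim k F (i + 1) (Function.update t i n) := by
  obtain ⟨d, rfl⟩ : ∃ d, k = i + (d + 1) := ⟨k - i - 1, by omega⟩
  have h1 : i + (d + 1) - i = d + 1 := by omega
  have h2 : i + (d + 1) - (i + 1) = d := by omega
  have h3 : i + (d + 1) - (d + 1) = i := by omega
  simp only [limFrom, h1, h2, limTower, h3]

theorem limFrom_update {k i : ℕ} (hi : i < k) (F : (ℕ → ℕ) → E) (t : ℕ → ℕ) (n : ℕ) :
    limFrom lim k F i (Function.update t i n) = limFrom lim k F i t := by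
  simp only [limFrom_of_lt lim hi, Function.update_idem]

theorem limFrom_mem {S : Set E} (hS : ∀ x : ℕ → E, (∀ n, x n ∈ S) → lim x ∈ S) {k : ℕ}
    {F : (ℕ → ℕ) → E} (hF : ∀ t, F t ∈ S) (i : ℕ) (t : ℕ → ℕ) : limFrom lim k F i t ∈ S := by
  unfold limFrom
  generalize k - i = d
  induction d generalizing t with
  | zero => exact hF t
  | succ d ih => exact hS _ fun n => ih _

end limFrom

theorem limFrom_ulim_mem {a b : ℝ} {k : ℕ} {F : (ℕ → ℕ) → ℝ} (hF : ∀ t, F t ∈ Set.Icc a b)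
    (i : ℕ) (t : ℕ → ℕ) : limFrom ulim k F i t ∈ Set.Icc a b :=
  limFrom_mem ulim (fun _ hx => (tendsto_ulim_of_mem_Icc hx).2) hF i t

theorem tendsto_limFrom_ulim {a b : ℝ} {k i : ℕ} (hi : i < k) {F : (ℕ → ℕ) → ℝ}
    (hF : ∀ t, F t ∈ Set.Icc a b) (t : ℕ → ℕ) :
    Tendsto (fun n => limFrom ulim k F (i + 1) (Function.update t i n)) (hyperfilter ℕ)
      (nhds (limFrom ulim k F i t)) := by
  rw [limFrom_of_lt ulim hi]
  exact (tendsto_ulim_of_mem_Icc fun n => limFrom_ulim_mem hF _ _).1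

/-! ## Trees of increments -/

open JamesSpace

/-- The coordinatewise limit of `f` in the entries from the `i`-th on. -/
noncomputable def branch (k : ℕ) (f : (ℕ → ℕ) → JamesSpace) (i : ℕ) (t : ℕ → ℕ) : JamesSpace :=
  limFrom wlim k f i t

/-- The increment of the tree of limits of `f` at the entry `t m`. -/
noncomputable def incr (k : ℕ) (f : (ℕ → ℕ) → JamesSpace) (m : ℕ) (t : ℕ → ℕ) : JamesSpace :=
  branch k f (m + 1) t - branch k f m t

/-- The squared norm of an increment. -/
noncomputable def incrSq (k : ℕ) (f : (ℕ → ℕ) → JamesSpace) (m : ℕ) (t : ℕ → ℕ) : ℝ :=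
  ‖incr k f m t‖ ^ 2

/-- The sum of the coordinates of an increment. -/
noncomputable def incrTotal (k : ℕ) (f : (ℕ → ℕ) → JamesSpace) (m : ℕ) (t : ℕ → ℕ) : ℝ :=
  (incr k f m t).total

/-- The asymptotic squared norm of the increments at level `m`. -/
noncomputable def limSq (k : ℕ) (f : (ℕ → ℕ) → JamesSpace) (m : ℕ) : ℝ :=
  limFrom ulim (m + 1) (incrSq k f m) 0 0

/-- The asymptotic sum of the coordinates of the increments at level `m`. -/
noncomputable def limTotal (k : ℕ) (f : (ℕ → ℕ) → JamesSpace) (m : ℕ) : ℝ :=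
  limFrom ulim (m + 1) (incrTotal k f m) 0 0

/-- The entries `t 0, …, t (i - 1)` are such that norms and sums of the increments at the
remaining levels are asymptotically within `η` of their generic values. -/
def Typical (k : ℕ) (f : (ℕ → ℕ) → JamesSpace) (η : ℝ) (i : ℕ) (t : ℕ → ℕ) : Prop :=
  ∀ m ∈ Finset.range k, i ≤ m + 1 →
    |limFrom ulim (m + 1) (incrSq k f m) i t - limSq k f m| < η ∧
    |limFrom ulim (m + 1) (incrTotal k f m) i t - limTotal k f m| < η

section tree

variable {k : ℕ} {f : (ℕ → ℕ) → JamesSpace} {C : ℝ}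

theorem branch_self (t : ℕ → ℕ) : branch k f k t = f t := limFrom_self _ _ _ _

theorem branch_update {i : ℕ} (hi : i < k) (t : ℕ → ℕ) (n : ℕ) :
    branch k f i (Function.update t i n) = branch k f i t := limFrom_update _ hi _ _ _

theorem branch_succ_update {i : ℕ} (hi : i < k) (t : ℕ → ℕ) (n : ℕ) :
    branch k f (i + 1) (Function.update t i n) =
      branch k f i t + incr k f i (Function.update t i n) := by
  rw [incr, branch_update hi, add_sub_cancel]

theorem norm_branch_le (hf : ∀ t, ‖f t‖ ≤ C) (i : ℕ) (t : ℕ → ℕ) : ‖branch k f i t‖ ≤ C :=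
  limFrom_mem wlim (S := {x | ‖x‖ ≤ C}) (fun _ hx => norm_wlim_le hx) hf i t

theorem norm_incr_le (hf : ∀ t, ‖f t‖ ≤ C) (m : ℕ) (t : ℕ → ℕ) : ‖incr k f m t‖ ≤ 2 * C :=
  (norm_sub_le _ _).trans
    (by linarith [norm_branch_le (k := k) hf (m + 1) t, norm_branch_le (k := k) hf m t])

theorem incrSq_mem (hf : ∀ t, ‖f t‖ ≤ C) (m : ℕ) (t : ℕ → ℕ) :
    incrSq k f m t ∈ Set.Icc 0 ((2 * C) ^ 2) :=
  ⟨sq_nonneg _, pow_le_pow_left₀ (norm_nonneg _) (norm_incr_le hf m t) 2⟩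

theorem incrTotal_mem (hf : ∀ t, ‖f t‖ ≤ C) (m : ℕ) (t : ℕ → ℕ) :
    incrTotal k f m t ∈ Set.Icc (-(2 * C)) (2 * C) :=
  abs_le.1 ((abs_total_le _).trans (norm_incr_le hf m t))

theorem limSq_nonneg (hf : ∀ t, ‖f t‖ ≤ C) (m : ℕ) : 0 ≤ limSq k f m :=
  (limFrom_ulim_mem (incrSq_mem hf m) _ _).1

theorem tendsto_coord_incr (hf : ∀ t, ‖f t‖ ≤ C) {i : ℕ} (hi : i < k) (t : ℕ → ℕ) (j : ℕ) :
    Tendsto (fun n => (incr k f i (Function.update t i n)).coord j) (hyperfilter ℕ) (nhds 0) := by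
  have h : Tendsto (fun n => (branch k f (i + 1) (Function.update t i n)).coord j)
      (hyperfilter ℕ) (nhds ((branch k f i t).coord j)) := by
    have he : branch k f i t = _ := limFrom_of_lt wlim hi f t
    rw [he]
    exact tendsto_coord_wlim (fun n => norm_branch_le hf (i + 1) (Function.update t i n)) j
  have h2 := h.sub_const ((branch k f i t).coord j)
  rw [sub_self] at h2
  refine h2.congr fun n => ?_
  rw [incr, branch_update hi, coord_sub]

theorem typical_zero {η : ℝ} (hη : 0 < η) : Typical k f η 0 0 := fun m _ _ => by
  simp [limSq, limTotal, hη]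

/-- Finitely many strict inequalities between iterated limits and constants: each is an open
condition, so it survives undoing one limit for almost every `n`. -/
theorem Typical.eventually (hf : ∀ t, ‖f t‖ ≤ C) {η : ℝ} {i : ℕ} {t : ℕ → ℕ}
    (h : Typical k f η i t) :
    ∀ᶠ n in (hyperfilter ℕ : Filter ℕ), Typical k f η (i + 1) (Function.update t i n) := by
  refine (eventually_all_finset _).2 fun m hm => ?_
  by_cases him : i + 1 ≤ m + 1
  · have h1 := h m hm (by omega)
    have h2 := ((tendsto_limFrom_ulim (by omega) (incrSq_mem (k := k) hf m) t).sub_const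
      (limSq k f m)).abs.eventually (gt_mem_nhds h1.1)
    have h3 := ((tendsto_limFrom_ulim (by omega) (incrTotal_mem (k := k) hf m) t).sub_const
      (limTotal k f m)).abs.eventually (gt_mem_nhds h1.2)
    filter_upwards [h2, h3] with n h2 h3 _
    exact ⟨h2, h3⟩
  · exact Eventually.of_forall fun n hn => absurd hn him

/-- The bound `i ≤ m + 1` in `Typical` keeps the newest level, where no limit remains to be taken
and the condition concerns the increment itself. -/
theorem Typical.incrSq {η : ℝ} {i : ℕ} (hi : i < k) {t : ℕ → ℕ} (h : Typical k f η (i + 1) t) :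
    |‖incr k f i t‖ ^ 2 - limSq k f i| < η := by
  have := (h i (Finset.mem_range.2 hi) le_rfl).1
  rwa [limFrom_self] at this

theorem Typical.incrTotal {η : ℝ} {i : ℕ} (hi : i < k) {t : ℕ → ℕ} (h : Typical k f η (i + 1) t) :
    |(incr k f i t).total - limTotal k f i| < η := by
  have := (h i (Finset.mem_range.2 hi) le_rfl).2
  rwa [limFrom_self] at this

end tree
open JamesSpace

/-! ## Interlacing tuples -/

/-- The first `i` entries of `t` and `t'` interlace: `t 0 ≤ t' 0 < t 1 ≤ t' 1 < ⋯`. -/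
def InterlacedBelow (i : ℕ) (t t' : ℕ → ℕ) : Prop :=
  (∀ a < i, t a ≤ t' a) ∧ ∀ a b, a < b → b < i → t' a < t b

/-- The first `i` entries of `t` increase strictly. -/
def IncreasingBelow (i : ℕ) (t : ℕ → ℕ) : Prop := ∀ a b, a < b → b < i → t a < t b

theorem IncreasingBelow.update {i n : ℕ} {t : ℕ → ℕ} (h : IncreasingBelow i t)
    (hn : ∀ a < i, t a < n) : IncreasingBelow (i + 1) (Function.update t i n) := by
  intro a b hab hb
  rw [Function.update_of_ne (by omega)]
  rcases Nat.lt_succ_iff_lt_or_eq.1 hb with hb | rfl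
  · rw [Function.update_of_ne (by omega)]
    exact h a b hab hb
  · rw [Function.update_self]
    exact hn a hab

theorem exists_forall_lt_le (i : ℕ) (t : ℕ → ℕ) : ∃ b, ∀ a < i, t a ≤ b :=
  ⟨∑ a ∈ Finset.range i, t a, fun _ ha =>
    Finset.single_le_sum (fun _ _ => Nat.zero_le _) (Finset.mem_range.2 ha)⟩

/-! ### Lower and upper estimates along the tree. -/

section estimates

variable {k : ℕ} {f : (ℕ → ℕ) → JamesSpace} {C : ℝ}

theorem Typical.exists_step (hf : ∀ t, ‖f t‖ ≤ C) {η : ℝ} {i : ℕ} (hi : i < k) {t : ℕ → ℕ}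
    (h : Typical k f η i t) (b N : ℕ) {κ : ℝ} (hκ : 0 < κ) :
    ∃ n v M, b < n ∧ Typical k f η (i + 1) (Function.update t i n) ∧ N ≤ M ∧ SuppGE v N ∧
      SuppLT v M ∧ ‖incr k f i (Function.update t i n) - v‖ ≤ κ := by
  obtain ⟨n, h1, ⟨v, M, h2⟩, h3⟩ := ((h.eventually hf).and
    ((eventually_exists_block (tendsto_coord_incr hf hi t) N hκ).and
      (Nat.hyperfilter_le_atTop (eventually_gt_atTop b)))).exists
  exact ⟨n, v, M, h3, h1, h2⟩

/-- The two tuples grow alternately, and each new increment is almost a block beyond all earlier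
ones, so the lower 2-estimate applies. Only the blocks coming from `t` are counted. -/
theorem exists_interlaced (hf : ∀ t, ‖f t‖ ≤ C) {η κ : ℝ} (hη : 0 < η) (hκ : 0 < κ) :
    ∀ i ≤ k, ∃ t t' w N, Typical k f η i t ∧ Typical k f η i t' ∧ InterlacedBelow i t t' ∧
      SuppLT w N ∧ ‖branch k f i t - branch k f i t' - w‖ ≤ 2 * i * κ ∧
      ∑ j ∈ Finset.range i, (limSq k f j / 2 - (η / 2 + κ ^ 2)) ≤ ‖w‖ ^ 2 := by
  intro i
  induction i with
  | zero =>
    refine fun _ => ⟨0, 0, 0, 0, typical_zero hη, typical_zero hη, ⟨by simp, by simp⟩, ?_, ?_, ?_⟩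
    · exact fun _ _ => rfl
    · simp
    · simp
  | succ i ih =>
    intro hi
    obtain ⟨t, t', w, N, ht, ht', hint, hw, hz, hsum⟩ := ih (by omega)
    obtain ⟨b, hb⟩ := exists_forall_lt_le i t'
    obtain ⟨n, v, M, hn, htn, hNM, hv, hvM, huv⟩ := ht.exists_step hf hi b N hκ
    obtain ⟨m, v', M', hm, htm, hMM, hv', hvM', huv'⟩ := ht'.exists_step hf hi n M hκ
    refine ⟨Function.update t i n, Function.update t' i m, w + v + -v', M', htn, htm, ⟨?_, ?_⟩,
      ((hw.mono hNM).add hvM).mono hMM |>.add hvM'.neg, ?_, ?_⟩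
    · intro a ha
      rcases Nat.lt_succ_iff_lt_or_eq.1 ha with ha | rfl
      · rw [Function.update_of_ne ha.ne, Function.update_of_ne ha.ne]
        exact hint.1 a ha
      · rw [Function.update_self, Function.update_self]
        exact hm.le
    · intro a c hac hc
      rw [Function.update_of_ne (by omega)]
      rcases Nat.lt_succ_iff_lt_or_eq.1 hc with hc | rfl
      · rw [Function.update_of_ne hc.ne]
        exact hint.2 a c hac hc
      · rw [Function.update_self]
        exact (hb a hac).trans_lt hn
    · have he : branch k f (i + 1) (Function.update t i n) -
          branch k f (i + 1) (Function.update t' i m) - (w + v + -v') =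
          (branch k f i t - branch k f i t' - w) + (incr k f i (Function.update t i n) - v) -
            (incr k f i (Function.update t' i m) - v') := by
        rw [branch_succ_update hi, branch_succ_update hi]; abel
      rw [he]
      refine (norm_sub_le _ _).trans ((add_le_add (norm_add_le _ _) le_rfl).trans ?_)
      push_cast
      linarith
    · have h1 := norm_sq_add_norm_sq_le hw hv
      have h2 := norm_sq_add_norm_sq_le ((hw.mono hNM).add hvM) hv'.neg
      have h3 := (abs_lt.1 (htn.incrSq hi)).1
      have h4 : ‖incr k f i (Function.update t i n)‖ ≤ ‖v‖ + κ := by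
        have := norm_sub_norm_le (incr k f i (Function.update t i n)) v
        linarith
      have h5 := pow_le_pow_left₀ (norm_nonneg _) h4 2
      rw [Finset.sum_range_succ]
      -- From `(‖v‖ + κ)² ≤ 2‖v‖² + 2κ²`; this costs the factor 1/2 and the error `η / 2 + κ ^ 2`.
      nlinarith [sq_nonneg (‖v‖ - κ), sq_nonneg ‖-v'‖]

/-- A Lipschitz condition on interlacing pairs bounds the sum of the asymptotic squared norms. -/
theorem sum_limSq_le (hf : ∀ t, ‖f t‖ ≤ C) {L : ℝ}
    (hL : ∀ t t', InterlacedBelow k t t' → ‖f t - f t'‖ ≤ L) :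
    ∑ j ∈ Finset.range k, limSq k f j ≤ 2 * (L + 1) ^ 2 + 2 := by
  have hk : (0 : ℝ) < k + 1 := by positivity
  -- Chosen so that the `2 * k` perturbations by `κ` cost at most 1 in norm.
  have hκ : (0 : ℝ) < 1 / (2 * (k + 1)) := by positivity
  have hκe : 2 * (1 / (2 * ((k : ℝ) + 1))) * (k + 1) = 1 := by field_simp
  set κ : ℝ := 1 / (2 * (k + 1)) with hκdef
  obtain ⟨t, t', w, N, -, -, hint, -, hz, hsum⟩ := exists_interlaced (k := k) hf hκ hκ k le_rfl
  rw [branch_self, branch_self] at hz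
  have h1 := hL t t' hint
  have h2 : ‖w‖ ≤ L + 1 := by
    have := norm_sub_norm_le w (f t - f t')
    rw [norm_sub_rev w] at this
    nlinarith
  have h3 := pow_le_pow_left₀ (norm_nonneg _) h2 2
  rw [Finset.sum_sub_distrib, ← Finset.sum_div, Finset.sum_const, Finset.card_range,
    nsmul_eq_mul] at hsum
  have h4 : κ ≤ 1 := by nlinarith [(Nat.cast_nonneg k : (0 : ℝ) ≤ k)]
  have h5 : (k : ℝ) * (κ / 2 + κ ^ 2) ≤ 1 := by nlinarith [(Nat.cast_nonneg k : (0 : ℝ) ≤ k)]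
  linarith

/-- Plain triangle inequality, with no 2-estimate; affordable only on a block of levels with small
total square. -/
theorem exists_extension (hf : ∀ t, ‖f t‖ ≤ C) {η : ℝ} {i : ℕ} {c : ℕ → ℕ}
    (hc : Typical k f η i c) (hinc : IncreasingBelow i c) (b : ℕ) :
    ∀ j, i + j ≤ k → ∃ t, Typical k f η (i + j) t ∧ IncreasingBelow (i + j) t ∧
      (∀ a < i, t a = c a) ∧ (∀ a, i ≤ a → a < i + j → b < t a) ∧
      ‖branch k f (i + j) t - branch k f i c‖ ≤
        ∑ m ∈ Finset.range j, Real.sqrt (limSq k f (i + m) + η) := by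
  intro j
  induction j with
  | zero => exact fun _ => ⟨c, hc, hinc, fun _ _ => rfl, fun a _ _ => by omega, by simp⟩
  | succ j ih =>
    intro hj
    obtain ⟨t, ht, htinc, htc, htb, hn⟩ := ih (by omega)
    obtain ⟨b', hb'⟩ := exists_forall_lt_le (i + j) t
    have hi : i + j < k := by omega
    obtain ⟨n, -, -, hbn, htn, -⟩ := ht.exists_step hf hi (max b b') 0 one_pos
    refine ⟨Function.update t (i + j) n, htn, htinc.update fun a ha => ?_, fun a ha => ?_,
      fun a ha ha' => ?_, ?_⟩
    · have := hb' a ha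
      omega
    · rw [Function.update_of_ne (by omega), htc a ha]
    · rcases (by omega : a < i + j ∨ a = i + j) with h | rfl
      · rw [Function.update_of_ne h.ne]
        exact htb a ha h
      · rw [Function.update_self]
        omega
    · rw [Finset.sum_range_succ, ← add_assoc, branch_succ_update hi, add_sub_right_comm]
      refine (norm_add_le _ _).trans (add_le_add hn ?_)
      refine Real.le_sqrt_of_sq_le ?_
      have := (abs_lt.1 (htn.incrSq hi)).2
      linarith

/-- One entry `n` continues both tuples. The sums of both new increments are within `η` of
`limTotal`, hence nearly cancel, and the difference is close to a block of sum zero, to which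
`EndBound.add` applies. -/
theorem exists_common_extension (hf : ∀ t, ‖f t‖ ≤ C) {η κ : ℝ} (hκ : 0 < κ)
    (hηκ : 2 * η ≤ κ) {i : ℕ} {c c' : ℕ → ℕ} (hc : Typical k f η i c) (hc' : Typical k f η i c')
    (hinc : IncreasingBelow i c) (hinc' : IncreasingBelow i c') {Z : ℝ}
    (hZ : ‖branch k f i c - branch k f i c'‖ ≤ Z) :
    ∀ j, i + j ≤ k → ∃ t t' w N, Typical k f η (i + j) t ∧ Typical k f η (i + j) t' ∧
      IncreasingBelow (i + j) t ∧ IncreasingBelow (i + j) t' ∧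
      (∀ a < i, t a = c a) ∧ (∀ a < i, t' a = c' a) ∧
      SuppLT w N ∧ EndBound w N (2 * (Z + κ) ^ 2 +
        ∑ m ∈ Finset.range j, (16 * (limSq k f (i + m) + η) + 36 * κ ^ 2)) ∧
      ‖branch k f (i + j) t - branch k f (i + j) t' - w‖ ≤ κ + j * (3 * κ) := by
  intro j
  induction j with
  | zero =>
    intro _
    obtain ⟨w, N, hw, h1, h2⟩ := exists_suppLT (branch k f i c - branch k f i c') hκ
    refine ⟨c, c', w, N, hc, hc', hinc, hinc', fun _ _ => rfl, fun _ _ => rfl, hw,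
      (endBound_two_mul_norm_sq w N).mono ?_, by simpa using h1⟩
    have h3 : ‖w‖ ≤ Z + κ := by linarith
    have h4 := pow_le_pow_left₀ (norm_nonneg _) h3 2
    simp only [Finset.range_zero, Finset.sum_empty]
    linarith
  | succ j ih =>
    intro hj
    obtain ⟨t, t', w, N, ht, ht', htinc, htinc', htc, htc', hw, hB, hz⟩ := ih (by omega)
    have hi : i + j < k := by omega
    obtain ⟨b, hb⟩ := exists_forall_lt_le (i + j) t
    obtain ⟨b', hb'⟩ := exists_forall_lt_le (i + j) t'
    have hu : ∀ q, Tendsto (fun n => (incr k f (i + j) (Function.update t (i + j) n) -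
        incr k f (i + j) (Function.update t' (i + j) n)).coord q) (hyperfilter ℕ) (nhds 0) := by
      intro q
      have := (tendsto_coord_incr hf hi t q).sub (tendsto_coord_incr hf hi t' q)
      rwa [sub_zero] at this
    have hlarge : ∀ᶠ n in (hyperfilter ℕ : Filter ℕ), max b b' < n :=
      Nat.hyperfilter_le_atTop (eventually_gt_atTop _)
    obtain ⟨n, h1, h2, ⟨v, M, hNM, hv, hvM, huv⟩, hbn⟩ := ((ht.eventually hf).and
      ((ht'.eventually hf).and ((eventually_exists_block hu N hκ).and hlarge))).exists
    have hbn' := (le_max_right b b').trans_lt hbn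
    replace hbn := (le_max_left b b').trans_lt hbn
    set s := Function.update t (i + j) n with hs
    set s' := Function.update t' (i + j) n with hs'
    have htot : |(incr k f (i + j) s - incr k f (i + j) s').total| ≤ κ := by
      have e1 := abs_lt.1 (h1.incrTotal hi)
      have e2 := abs_lt.1 (h2.incrTotal hi)
      rw [total_sub, abs_le]
      constructor <;> linarith
    obtain ⟨v', M', hNM', hv', hvM', hv0, huv'⟩ := exists_block_sum_zero hNM hv hvM huv htot
    refine ⟨s, s', w + v', M', h1, h2, htinc.update fun a ha => (hb a ha).trans_lt hbn,
      htinc'.update fun a ha => (hb' a ha).trans_lt hbn', fun a ha => ?_, fun a ha => ?_,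
      (hw.mono hNM').add hvM', (hB.add hw hv' hNM' hv0).mono ?_, ?_⟩
    · rw [hs, Function.update_of_ne (by omega), htc a ha]
    · rw [hs', Function.update_of_ne (by omega), htc' a ha]
    · rw [Finset.sum_range_succ, ← add_assoc]
      have e1 := (abs_lt.1 (h1.incrSq hi)).2
      have e2 := (abs_lt.1 (h2.incrSq hi)).2
      have e3 := norm_sub_le (incr k f (i + j) s) (incr k f (i + j) s')
      have e4 : ‖v'‖ ≤ ‖incr k f (i + j) s‖ + ‖incr k f (i + j) s'‖ + 3 * κ := by
        have := norm_sub_norm_le v' (incr k f (i + j) s - incr k f (i + j) s')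
        rw [norm_sub_rev v'] at this
        linarith
      have e5 := pow_le_pow_left₀ (norm_nonneg _) e4 2
      -- Uses `(a + b + 3κ)² ≤ 4(a² + b²) + 18κ²`; `EndBound.add` doubles this, giving 16 and 36.
      nlinarith [sq_nonneg (‖incr k f (i + j) s‖ - ‖incr k f (i + j) s'‖),
        sq_nonneg (‖incr k f (i + j) s‖ + ‖incr k f (i + j) s'‖ - 3 * κ)]
    · have he : branch k f (i + j + 1) s - branch k f (i + j + 1) s' - (w + v') =
          (branch k f (i + j) t - branch k f (i + j) t' - w) +
            ((incr k f (i + j) s - incr k f (i + j) s') - v') := by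
        rw [hs, hs', branch_succ_update hi, branch_succ_update hi]; abel
      rw [← add_assoc, he]
      refine (norm_add_le _ _).trans ?_
      push_cast
      linarith

end estimates

/-! ### Combining the estimates. -/

/-- Among `r` successive blocks of length `r` one carries at most the average. -/
theorem exists_block_sum_le {r : ℕ} (hr : 0 < r) {α : ℕ → ℝ} {M : ℝ}
    (h : ∑ j ∈ Finset.range (r * r), α j ≤ M) :
    ∃ i, i + r ≤ r * r ∧ r * ∑ m ∈ Finset.range r, α (i + m) ≤ M := by
  have hsum : ∀ s, ∑ j ∈ Finset.range (s * r), α j =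
      ∑ q ∈ Finset.range s, ∑ m ∈ Finset.range r, α (q * r + m) := by
    intro s
    induction s with
    | zero => simp
    | succ s ih => rw [Nat.succ_mul, Finset.sum_range_add, ih, Finset.sum_range_succ]
  have hr' : (r : ℝ) ≠ 0 := by positivity
  obtain ⟨q, hq, hle⟩ := Finset.exists_le_of_sum_le (s := Finset.range r)
    (f := fun q => ∑ m ∈ Finset.range r, α (q * r + m)) (g := fun _ => M / r)
    ⟨0, Finset.mem_range.2 hr⟩ (by
      rw [← hsum, Finset.sum_const, Finset.card_range, nsmul_eq_mul, mul_div_cancel₀ _ hr']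
      exact h)
  refine ⟨q * r, ?_, ?_⟩
  · have := Nat.mul_le_mul_right r (Finset.mem_range.1 hq)
    rwa [Nat.succ_mul] at this
  · rw [mul_comm]
    exact (le_div_iff₀ (by positivity)).1 hle

/-- Distant tuples, which agree outside of a block of length `r`, with close images. -/
theorem exists_far_tuples_close_images {L : ℝ} : ∃ D : ℝ, ∀ (r : ℕ), 0 < r →
    ∀ (f : (ℕ → ℕ) → JamesSpace) (C : ℝ), (∀ t, ‖f t‖ ≤ C) →
    (∀ t t', InterlacedBelow (r * r) t t' → ‖f t - f t'‖ ≤ L) →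
    ∃ t t' i, IncreasingBelow (r * r) t ∧ IncreasingBelow (r * r) t' ∧ i + r ≤ r * r ∧
      (∀ a < i + r, ∀ b, i ≤ b → b < r * r → t a < t' b) ∧ ‖f t - f t'‖ ≤ D := by
  set A : ℝ := 2 * (L + 1) ^ 2 + 2 with hA
  have hA0 : 0 ≤ A := by positivity
  set Z : ℝ := 2 * Real.sqrt (A + 1) with hZ
  have hZ0 : 0 ≤ Z := by positivity
  -- `Z` bounds the difference after the changed block and `16 * A` comes from the common levels; 52
  -- leaves room for the `η` and `κ` errors, and the final 1 covers the distance to `w`.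
  refine ⟨Real.sqrt (2 * (Z + 1) ^ 2 + (16 * A + 52)) + 1, fun r hr f C hf hL => ?_⟩
  set k := r * r with hk
  have hsum := sum_limSq_le hf hL
  obtain ⟨i, hir, hblock⟩ := exists_block_sum_le hr hsum
  have hk0 : (0 : ℝ) ≤ k := Nat.cast_nonneg k
  have hκ : (0 : ℝ) < 1 / (4 * (k + 1)) := by positivity
  have hκe : 4 * (1 / (4 * ((k : ℝ) + 1))) * (k + 1) = 1 := by field_simp
  set κ : ℝ := 1 / (4 * (k + 1)) with hκdef
  have hη : 0 < κ / 2 := half_pos hκ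
  have hκ1 : κ ≤ 1 / 4 := by nlinarith
  have hkκ : k * κ ≤ 1 / 4 := by nlinarith
  obtain ⟨c, hc, hcinc, -⟩ := exists_extension hf (typical_zero (k := k) (f := f) hη)
    (fun a b _ hb => by omega) 0 i (by omega)
  rw [Nat.zero_add] at hc hcinc
  obtain ⟨t, ht, htinc, -, -, htn⟩ := exists_extension hf hc hcinc 0 r hir
  -- The second tuple extends the same `c`, but its block lies beyond every entry of `t` so far.
  obtain ⟨b₁, hb₁⟩ := exists_forall_lt_le (i + r) t
  obtain ⟨t', ht', htinc', -, htb', htn'⟩ := exists_extension hf hc hcinc b₁ r hir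
  have hS : ∑ m ∈ Finset.range r, Real.sqrt (limSq k f (i + m) + κ / 2) ≤ Real.sqrt (A + 1) := by
    -- Cauchy–Schwarz costs a factor `r`, exactly what the choice of block in `hblock` compensates.
    refine Real.le_sqrt_of_sq_le (sq_sum_le_card_mul_sum_sq.trans ?_)
    have e : ∀ m ∈ Finset.range r, Real.sqrt (limSq k f (i + m) + κ / 2) ^ 2 =
        limSq k f (i + m) + κ / 2 := fun m _ =>
      Real.sq_sqrt (by linarith [limSq_nonneg (k := k) hf (i + m)])
    rw [Finset.sum_congr rfl e, Finset.sum_add_distrib, Finset.sum_const, Finset.card_range,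
      nsmul_eq_mul, mul_add, ← mul_assoc]
    have : (k : ℝ) = r * r := by rw [hk]; push_cast; rfl
    rw [← this]
    linarith
  have hZ' : ‖branch k f (i + r) t - branch k f (i + r) t'‖ ≤ Z := by
    have e : branch k f (i + r) t - branch k f (i + r) t' =
        (branch k f (i + r) t - branch k f i c) - (branch k f (i + r) t' - branch k f i c) := by
      abel
    rw [e]
    refine (norm_sub_le _ _).trans ?_
    linarith
  obtain ⟨d, hd⟩ : ∃ d, i + r + d = k := ⟨k - (i + r), by omega⟩
  obtain ⟨T, T', w, N, -, -, hTinc, hTinc', hTt, hTt', hw, hB, hz⟩ :=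
    exists_common_extension hf hκ (by linarith) ht ht' htinc htinc' hZ' d hd.le
  rw [hd] at hTinc hTinc' hz
  rw [branch_self, branch_self] at hz
  refine ⟨T, T', i, hTinc, hTinc', hir, ?_, ?_⟩
  · intro a ha q hiq hq
    have h1 : ∀ q, i ≤ q → q < i + r → T a < T' q := fun q h1 h2 => by
      rw [hTt a ha, hTt' q h2]
      have := hb₁ a ha
      have := htb' q h1 h2
      omega
    rcases lt_or_ge q (i + r) with h | h
    · exact h1 q hiq h
    · exact (h1 i le_rfl (by omega)).trans (hTinc' i q (by omega) hq)
  · have h1 := hB.norm_sq_le hw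
    have hdk : (d : ℝ) ≤ k := by exact_mod_cast (by omega : d ≤ k)
    have hd0 : (0 : ℝ) ≤ d := Nat.cast_nonneg d
    have h2 : ∑ m ∈ Finset.range d, limSq k f (i + r + m) ≤ A := by
      refine le_trans ?_ hsum
      have := Finset.sum_range_add (limSq k f) (i + r) d
      rw [hd] at this
      have h0 : 0 ≤ ∑ x ∈ Finset.range (i + r), limSq k f x :=
        Finset.sum_nonneg fun j _ => limSq_nonneg hf j
      linarith
    rw [Finset.sum_add_distrib, ← Finset.mul_sum, Finset.sum_add_distrib, Finset.sum_const,
      Finset.sum_const, Finset.card_range, nsmul_eq_mul, nsmul_eq_mul] at h1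
    have h3 : d * κ ≤ 1 / 4 := by nlinarith
    have h4 : d * (36 * κ ^ 2) ≤ 9 := by nlinarith
    have h5 : (Z + κ) ^ 2 ≤ (Z + 1) ^ 2 := by gcongr; linarith
    have h6 : ‖w‖ ≤ Real.sqrt (2 * (Z + 1) ^ 2 + (16 * A + 52)) :=
      Real.le_sqrt_of_sq_le (by linarith)
    have h7 := norm_sub_norm_le (f T - f T') w
    linarith

/-! ## Distances in the interlacing graphs -/

/-- The number of entries of `n` that are at most `x`. -/
def countLE {k : ℕ} (x : ℕ) (n : IncTuple k) : ℕ := (Finset.univ.filter fun i => n.1 i ≤ x).card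

/-- Two indices `i < j` with `n` at most `x` and `m` above `x` would violate `m i ≤ n j`. Thus
`countLE x` is 1-Lipschitz for the graph distance. -/
theorem InterlacesLE.countLE_le {k : ℕ} {n m : IncTuple k} (h : InterlacesLE n m) (x : ℕ) :
    countLE x m ≤ countLE x n ∧ countLE x n ≤ countLE x m + 1 := by
  have hsub : (Finset.univ.filter fun i => m.1 i ≤ x) ⊆ Finset.univ.filter fun i => n.1 i ≤ x := by
    intro i hi
    simp only [Finset.mem_filter, Finset.mem_univ, true_and] at hi ⊢
    exact (h.1 i).trans hi
  refine ⟨Finset.card_le_card hsub, ?_⟩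
  have h1 : ((Finset.univ.filter fun i => n.1 i ≤ x) \
      Finset.univ.filter fun i => m.1 i ≤ x).card ≤ 1 := by
    refine Finset.card_le_one.2 fun i hi j hj => ?_
    simp only [Finset.mem_sdiff, Finset.mem_filter, Finset.mem_univ, true_and, not_le] at hi hj
    rcases lt_trichotomy i j with hij | hij | hij
    · have := h.2 i j hij
      omega
    · exact hij
    · have := h.2 j i hij
      omega
  have h2 := Finset.card_sdiff_add_card_eq_card hsub
  unfold countLE
  omega

theorem countLE_le_add_walk_length {k : ℕ} (x : ℕ) {n m : IncTuple k}
    (p : (kaltonGraph k).Walk n m) : countLE x n ≤ countLE x m + p.length := by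
  induction p with
  | nil => simp
  | cons hadj p ih =>
    rw [kaltonGraph, SimpleGraph.fromRel_adj] at hadj
    rw [SimpleGraph.Walk.length_cons]
    rcases hadj.2 with h | h
    · have := h.countLE_le x
      omega
    · have := h.countLE_le x
      omega

theorem countLE_le_add_dist {k : ℕ} {G : SimpleGraph (IncTuple k)} (hG : G ≤ kaltonGraph k)
    (hc : G.Connected) (x : ℕ) (n m : IncTuple k) : countLE x n ≤ countLE x m + G.dist n m := by
  obtain ⟨p, hp⟩ := (hc n m).exists_walk_length_eq_dist
  have := countLE_le_add_walk_length x (p.mapLe hG)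
  rwa [SimpleGraph.Walk.length_map, hp] at this

/-- If the first `i + r` entries of `n` lie below all but the first `i` entries of `m`, then
`n` and `m` have distance at least `r`. -/
theorem le_dist_of_forall_lt {k i r : ℕ} {G : SimpleGraph (IncTuple k)} (hG : G ≤ kaltonGraph k)
    (hc : G.Connected) (hir : i + r ≤ k) {n m : IncTuple k}
    (h : ∀ a b : Fin k, (a : ℕ) < i + r → i ≤ (b : ℕ) → n.1 a < m.1 b) : r ≤ G.dist n m := by
  rcases Nat.eq_zero_or_pos r with rfl | hr
  · exact Nat.zero_le _
  -- Counting up to the last of the first `i + r` entries of `n` separates the tuples: at least `i +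
  -- r` entries against at most `i`.
  let a₀ : Fin k := ⟨i + r - 1, by omega⟩
  have h1 := countLE_le_add_dist hG hc (n.1 a₀) n m
  have h2 : i + r ≤ countLE (n.1 a₀) n := by
    have : (Finset.univ.filter fun a : Fin k => (a : ℕ) < i + r).card = i + r := by
      rw [Fin.card_filter_val_lt, min_eq_right hir]
    rw [← this]
    refine Finset.card_le_card fun a ha => ?_
    simp only [Finset.mem_filter, Finset.mem_univ, true_and] at ha ⊢
    refine n.2.monotone ?_
    change (a : ℕ) ≤ i + r - 1
    omega
  have h3 : countLE (n.1 a₀) m ≤ i := by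
    have : (Finset.univ.filter fun a : Fin k => (a : ℕ) < i).card = i := by
      rw [Fin.card_filter_val_lt, min_eq_right (by omega)]
    rw [← this]
    refine Finset.card_le_card fun a ha => ?_
    simp only [Finset.mem_filter, Finset.mem_univ, true_and] at ha ⊢
    by_contra hia
    have := h a₀ a (by change i + r - 1 < i + r; omega) (by omega)
    omega
  omega

/-! ## Maps which are Lipschitz for interlacing -/

section Lipschitz

variable {E : Type*} [SeminormedAddCommGroup E] {k : ℕ} {φ : IncTuple k → E} {L : ℝ}

/-- Exchanging entries of `n` for those of `N`, last one first, takes `k` interlacing moves. -/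
theorem norm_sub_le_of_forall_le (hφ : ∀ n m, InterlacesLT n m → ‖φ n - φ m‖ ≤ L)
    {n N : IncTuple k} (hN : ∀ i j, n.1 i ≤ N.1 j) : ‖φ n - φ N‖ ≤ k * L := by
  let T : ℕ → IncTuple k := fun t => ⟨fun i => if (i : ℕ) < t then n.1 i else N.1 i, by
    intro i j hij
    have h1 := n.2 hij
    have h2 := N.2 hij
    have h3 := hN i i
    have hij' : (i : ℕ) < j := hij
    dsimp only
    split_ifs <;> omega⟩
  have hT : ∀ t : ℕ, ‖φ (T t) - φ (T 0)‖ ≤ t * L := by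
    intro t
    induction t with
    | zero => simp
    | succ t ih =>
      have hstep : InterlacesLT (T (t + 1)) (T t) := by
        refine ⟨fun i => ?_, fun i j hij => ?_⟩
        · have h3 := hN i i
          change (if (i : ℕ) < t + 1 then n.1 i else N.1 i) ≤ (if (i : ℕ) < t then n.1 i else N.1 i)
          split_ifs <;> omega
        · have h1 := n.2 hij
          have h2 := N.2 hij
          have hij' : (i : ℕ) < j := hij
          change (if (i : ℕ) < t then n.1 i else N.1 i) < (if (j : ℕ) < t + 1 then n.1 j else N.1 j)
          have h3 := hN i i
          split_ifs <;> omega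
      have := norm_sub_le_norm_sub_add_norm_sub (φ (T (t + 1))) (φ (T t)) (φ (T 0))
      have := hφ _ _ hstep
      push_cast
      linarith
  have h0 : T 0 = N := Subtype.ext (funext fun i => by simp [T])
  have hk : T k = n := Subtype.ext (funext fun i => by simp [T])
  have := hT k
  rwa [h0, hk] at this

/-- Any tuple and a fixed one are dominated by a common third. The bound depends on `k`, which is
harmless: it only makes the limits exist and does not enter `D`. -/
theorem exists_norm_le (hφ : ∀ n m, InterlacesLT n m → ‖φ n - φ m‖ ≤ L) :
    ∃ C, 0 ≤ C ∧ ∀ n, ‖φ n‖ ≤ C := by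
  let n₀ : IncTuple k := ⟨fun i => i, fun i j hij => hij⟩
  have hb : ∀ n, ‖φ n‖ ≤ ‖φ n₀‖ + 2 * (k * L) := by
    intro n
    let N : IncTuple k := ⟨fun i => (∑ j, n.1 j) + (∑ j, n₀.1 j) + i, fun i j hij => by
      have hij' : (i : ℕ) < j := hij
      dsimp only
      omega⟩
    have h1 := norm_sub_le_of_forall_le hφ (n := n) (N := N) fun i j => by
      have := Finset.single_le_sum (f := n.1) (fun _ _ => Nat.zero_le _) (Finset.mem_univ i)
      change _ ≤ (∑ j, n.1 j) + (∑ j, n₀.1 j) + (j : ℕ)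
      omega
    have h2 := norm_sub_le_of_forall_le hφ (n := n₀) (N := N) fun i j => by
      have := Finset.single_le_sum (f := n₀.1) (fun _ _ => Nat.zero_le _) (Finset.mem_univ i)
      change _ ≤ (∑ j, n.1 j) + (∑ j, n₀.1 j) + (j : ℕ)
      omega
    have h3 := norm_sub_le_norm_sub_add_norm_sub (φ n) (φ N) (φ n₀)
    have h4 := norm_sub_norm_le (φ n) (φ n₀)
    rw [norm_sub_rev (φ N)] at h3
    linarith
  exact ⟨_, (norm_nonneg _).trans (hb n₀), hb⟩

end Lipschitz

/-- Graphs on the increasing tuples that lie between the two interlacing graphs do not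
equi-coarsely embed into the James space. -/
theorem not_exists_isEquiCoarseEmbedding (G : ∀ k : ℕ, SimpleGraph (IncTuple k))
    (hG : ∀ k, strictKaltonGraph k ≤ G k) (hG' : ∀ k, G k ≤ kaltonGraph k) :
    ¬ ∃ φ : ∀ k : ℕ+, IncTuple k → JamesSpace,
      IsEquiCoarseEmbedding (fun (k : ℕ+) n m => ((G k).dist n m : ℝ≥0)) φ := by
  rintro ⟨φ, ρ, ω, hρ, -, hlim, hφ⟩
  have hlip : ∀ (k : ℕ+) (n m : IncTuple k), InterlacesLT n m →
      ‖φ k n - φ k m‖ ≤ (ω 1 : ℝ) := by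
    intro k n m h
    rcases eq_or_ne n m with rfl | hne
    · simp
    · have hadj : (strictKaltonGraph k).Adj n m := by
        rw [strictKaltonGraph, SimpleGraph.fromRel_adj]
        exact ⟨hne, Or.inl h⟩
      have h1 := (hφ k n m).2
      beta_reduce at h1
      rw [SimpleGraph.dist_eq_one_iff_adj.2 (hG k hadj), Nat.cast_one] at h1
      rw [← dist_eq_norm, ← coe_nndist]
      exact_mod_cast h1
  obtain ⟨D, hD⟩ := exists_far_tuples_close_images (L := (ω 1 : ℝ))
  have hbound : ∀ r : ℕ, 0 < r → (ρ r : ℝ) ≤ D := by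
    classical
    intro r hr
    let k : ℕ+ := ⟨r * r, Nat.mul_pos hr hr⟩
    -- The iterated limits need a bounded function of all sequences; the value 0 elsewhere is
    -- harmless, as the Lipschitz condition and the tuples obtained involve only increasing entries.
    let f : (ℕ → ℕ) → JamesSpace := fun t =>
      if h : StrictMono (fun i : Fin k => t i) then φ k ⟨_, h⟩ else 0
    have hmono : ∀ t, IncreasingBelow k t → StrictMono (fun i : Fin k => t i) :=
      fun t ht i j hij => ht i j hij j.2
    have hf : ∀ t (ht : IncreasingBelow k t), f t = φ k ⟨_, hmono t ht⟩ :=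
      fun t ht => dif_pos (hmono t ht)
    obtain ⟨C, hC, hle⟩ := exists_norm_le (hlip k)
    have hfC : ∀ t, ‖f t‖ ≤ C := by
      intro t
      by_cases h : StrictMono (fun i : Fin k => t i)
      · simp only [f, dif_pos h]
        exact hle _
      · simp only [f, dif_neg h, norm_zero]
        exact hC
    obtain ⟨t, t', i, ht, ht', hir, hlt, hdist⟩ := hD r hr f C hfC fun t t' h => by
      have h1 : IncreasingBelow k t := fun a b hab hb =>
        (h.1 a (hab.trans hb)).trans_lt (h.2 a b hab hb)
      have h2 : IncreasingBelow k t' := fun a b hab hb =>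
        (h.2 a b hab hb).trans_le (h.1 b hb)
      rw [hf t h1, hf t' h2]
      exact hlip k _ _ ⟨fun i => h.1 i i.2, fun i j hij => h.2 i j hij j.2⟩
    rw [hf t ht, hf t' ht', ← dist_eq_norm, ← coe_nndist] at hdist
    have hr' := le_dist_of_forall_lt (hG' k) ((strictKaltonGraph_connected k).mono (hG k))
      (i := i) (r := r) hir (n := ⟨_, hmono t ht⟩) (m := ⟨_, hmono t' ht'⟩)
      fun a b ha hb => hlt a ha b hb b.2
    refine le_trans ?_ hdist
    have := (hρ (Nat.cast_le.2 hr')).trans (hφ k _ _).1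
    exact_mod_cast this
  obtain ⟨r, hr, hr0⟩ := (((hlim.comp tendsto_natCast_atTop_atTop).eventually
    (eventually_gt_atTop (Real.toNNReal D))).and (eventually_gt_atTop 0)).exists
  have h1 := hbound r hr0
  have h2 : (Real.toNNReal D : ℝ) < ρ r := by exact_mod_cast hr
  linarith [Real.le_coe_toNNReal D]

theorem theorem8p1 :
    (¬ ∃ φ : ∀ k : ℕ+, IncTuple k → JamesSpace,
      IsEquiCoarseEmbedding (fun k : ℕ+ => kaltonDist k) φ) ∧
    (¬ ∃ φ : ∀ k : ℕ+, IncTuple k → JamesSpace,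
      IsEquiCoarseEmbedding (fun k : ℕ+ => strictKaltonDist k) φ) :=
  ⟨not_exists_isEquiCoarseEmbedding kaltonGraph strictKaltonGraph_le fun _ => le_rfl,
    not_exists_isEquiCoarseEmbedding strictKaltonGraph (fun _ => le_rfl) strictKaltonGraph_le⟩
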